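/- Let $d\ge 1$ be an integer and let $\varrho$ be a radial kernel on $\mathbb{R}^d$, $\varrho(\eta)=\varrho(|\eta|)$, satisfying $$\textrm{(K)}\qquad \varrho\in L^1_{\mathrm{loc}}(\mathbb{R}^d),\quad \varrho\ge 0,\quad r\mapsto\frac{\varrho(r)}{r}\ \text{is nonincreasing on }(0,\infty),\quad \int_{\mathbb{R}^d}\min\{1,|\eta|^{-1}\}\,\varrho(|\eta|)\,d\eta<\infty .$$ Then $\Psi(r):=\int_r^\infty \frac{\varrho(\theta)}{\theta}\,d\theta$ is a convergent integral for every $r>0$. Suppose in addition that $$ r^{d-1}\Psi(r)\in L^1_{\mathrm{loc}}([0,\infty)),\qquad \Psi\in C^2((0,\infty)).$$ With $e_1=(1,0,\dots,0)$, define for $\varepsilon,\varepsilon'>0$ and $|\eta|>0$ the truncated equivalence kernel $$\varrho_{\mathrm{eq},\varepsilon,\varepsilon'}(|\eta|):=|\eta|^d\int_{\mathbb{R}^d}\chi_{\{|e_1-z|>\varepsilon'\}}\,\chi_{\{|z|>\varepsilon\}}\,\frac{\varrho(|\eta||z|)}{|z|}\,\frac{\varrho(|\eta||e_1-z|)}{|e_1-z|}\;\frac{e_1-z}{|e_1-z|}\cdot\frac{z}{|z|}\,dz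 .$$ Then these integrals converge absolutely, $\eta\mapsto\varrho_{\mathrm{eq},\varepsilon,\varepsilon'}(|\eta|)$ is measurable for all $\varepsilon,\varepsilon'>0$, and for every $\eta$ with $|\eta|>0$ the (finite) limit $$\varrho_{\mathrm{eq}}(|\eta|):=\lim_{\varepsilon,\varepsilon'\to0^+}\varrho_{\mathrm{eq},\varepsilon,\varepsilon'}(|\eta|)$$ exists, where $\varepsilon$ and $\varepsilon'$ tend to $0$ independently. Thus a pointwise equivalence kernel is defined on $\mathbb{R}^d\setminus\{0\}$. -/

import Mathlib

open Set Filter Topology MeasureTheory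

/-- The standing conditions on a radial kernel on `ℝ^d`. The function `ρ` is the radial profile: the kernel is
`η ↦ ρ ‖η‖`, and only the values of `ρ` on `(0, ∞)` matter. -/
structure IsRadialKernel (d : ℕ) (ρ : ℝ → ℝ) : Prop where
  locallyIntegrable : LocallyIntegrable (fun η : EuclideanSpace ℝ (Fin d) => ρ ‖η‖)
  nonneg : ∀ r : ℝ, 0 < r → 0 ≤ ρ r
  antitone : AntitoneOn (fun r : ℝ => ρ r / r) (Ioi 0)
  integrable : Integrable (fun η : EuclideanSpace ℝ (Fin d) => min 1 ‖η‖⁻¹ * ρ ‖η‖)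

/-- `Ψ(r) = ∫_r^∞ ρ(θ)/θ dθ`. -/
noncomputable def kernelPsi (ρ : ℝ → ℝ) (r : ℝ) : ℝ :=
  ∫ θ in Ioi r, ρ θ / θ

/-- The first standard basis vector of `ℝ^d`, `d ≥ 1`. -/
noncomputable def firstVec (d : ℕ) [NeZero d] : EuclideanSpace ℝ (Fin d) :=
  EuclideanSpace.single 0 1

/-- The set `{z : |e₁ - z| > ε', |z| > ε}`. -/
def truncationSet (d : ℕ) [NeZero d] (ε ε' : ℝ) : Set (EuclideanSpace ℝ (Fin d)) :=
  {z | ε' < ‖firstVec d - z‖ ∧ ε < ‖z‖}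

/-- The integrand of the equivalence kernel at radius `r = |η|`, before truncation. -/
noncomputable def eqIntegrand (d : ℕ) [NeZero d] (ρ : ℝ → ℝ) (r : ℝ)
    (z : EuclideanSpace ℝ (Fin d)) : ℝ :=
  ρ (r * ‖z‖) / ‖z‖ * (ρ (r * ‖firstVec d - z‖) / ‖firstVec d - z‖) *
    inner ℝ (‖firstVec d - z‖⁻¹ • (firstVec d - z)) (‖z‖⁻¹ • z)

/-- The truncated equivalence kernel `ρ_{eq,ε,ε'}(r)`. -/
noncomputable def truncatedEqKernel (d : ℕ) [NeZero d] (ρ : ℝ → ℝ) (ε ε' r : ℝ) : ℝ :=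
  r ^ d * ∫ z, (truncationSet d ε ε').indicator (eqIntegrand d ρ r) z

/-- The pointwise equivalence kernel: the limit of `ρ_{eq,ε,ε'}(r)` as `ε, ε' → 0⁺` independently
(a junk value if that limit does not exist). -/
noncomputable def eqKernel (d : ℕ) [NeZero d] (ρ : ℝ → ℝ) (r : ℝ) : ℝ :=
  limUnder (𝓝[>] (0 : ℝ) ×ˢ 𝓝[>] (0 : ℝ)) fun p : ℝ × ℝ => truncatedEqKernel d ρ p.1 p.2 r

/-! Fix r = |η| and put k(s) = ρ(rs)/s, which is nonnegative and nonincreasing, with min(1,|z|)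
k(|z|) integrable. The integrand is k(|z|) times the inner product of F(z) = k(|e-z|)(e-z)/|e-z|
with z/|z|, singular only at 0 and e. Off both points one factor is bounded by monotonicity and the
other is integrable. Near 0, F(z) = F(0) + O(|z|) once k is differentiable at 1. The F(0) term is
odd and integrates to zero over annuli; the remainder is O(|z| k(|z|)), hence integrable
(`exists_tendsto_integral_annulus`). The reflection z ↦ e - z carries this to e, and since the two
small balls are disjoint the truncations decouple (`exists_tendsto_integral_truncation`).
Differentiability comes from Ψ being C²: convexity gives Ψ' = -ρ(x)/x, so ρ = -xΨ' is
differentiable. -/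

/-- Off a ball around the origin, a kernel with `min(1, |z|) k(|z|)` integrable is integrable. -/
lemma integrableOn_norm_gt {E : Type*} [NormedAddCommGroup E] [MeasurableSpace E] [BorelSpace E]
    {μ : Measure E} {k : ℝ → ℝ} (hk : Measurable k)
    (hi : Integrable (fun z : E => min 1 ‖z‖ * k ‖z‖) μ) {ε : ℝ} (hε : 0 < ε) :
    IntegrableOn (fun z : E => k ‖z‖) {z | ε < ‖z‖} μ := by
  have hs : MeasurableSet {z : E | ε < ‖z‖} := measurableSet_lt measurable_const measurable_norm
  refine Integrable.mono' ((hi.norm.const_mul (min 1 ε)⁻¹).integrableOn)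
    (hk.comp measurable_norm).aestronglyMeasurable ?_
  filter_upwards [ae_restrict_mem hs] with z hz
  have hm : 0 < min 1 ε := lt_min one_pos hε
  have hz' : min 1 ε ≤ min 1 ‖z‖ := min_le_min le_rfl (le_of_lt hz)
  rw [norm_mul, ← mul_assoc]
  refine le_mul_of_one_le_left (norm_nonneg _) ?_
  rw [Real.norm_eq_abs, abs_of_pos (hm.trans_le hz')]
  rw [inv_mul_eq_div, one_le_div hm]
  exact hz'

/-! ### Principal values for a general profile k -/

section Kernel

variable {E : Type*} [NormedAddCommGroup E] [InnerProductSpace ℝ E]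

/-- The radial interaction density `k(|z|) k(|e - z|) cos ∠(e - z, z)`. -/
noncomputable def interactionDensity (k : ℝ → ℝ) (e z : E) : ℝ :=
  k ‖z‖ * k ‖e - z‖ * inner ℝ (‖e - z‖⁻¹ • (e - z)) (‖z‖⁻¹ • z)

/-- The reflection exchanges the singularities 0 and e, so only the one at 0 needs analysis. -/
lemma interactionDensity_sub (k : ℝ → ℝ) (e z : E) :
    interactionDensity k e (e - z) = interactionDensity k e z := by
  unfold interactionDensity
  rw [sub_sub_cancel, real_inner_comm, mul_comm (k ‖z‖)]

lemma norm_inv_norm_smul_le_one (z : E) : ‖‖z‖⁻¹ • z‖ ≤ 1 := by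
  rw [norm_smul, norm_inv, norm_norm]
  exact inv_mul_le_one

lemma abs_interactionDensity_le (k : ℝ → ℝ) (e z : E) :
    |interactionDensity k e z| ≤ |k ‖z‖| * |k ‖e - z‖| := by
  unfold interactionDensity
  rw [abs_mul, abs_mul]
  have h := abs_real_inner_le_norm (‖e - z‖⁻¹ • (e - z)) (‖z‖⁻¹ • z)
  have h1 := norm_inv_norm_smul_le_one (e - z)
  have h2 := norm_inv_norm_smul_le_one z
  exact mul_le_of_le_one_right (by positivity) (h.trans (mul_le_one₀ h1 (norm_nonneg _) h2))

lemma interactionDensity_eq_inner (k : ℝ → ℝ) (e z : E) :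
    interactionDensity k e z =
      k ‖z‖ * inner ℝ ((k ‖e - z‖ * ‖e - z‖⁻¹) • (e - z)) (‖z‖⁻¹ • z) := by
  unfold interactionDensity
  rw [mul_smul, real_inner_smul_left _ _ (k _), mul_assoc]

variable [MeasurableSpace E] [BorelSpace E]

lemma measurable_interactionDensity [SecondCountableTopology E] {k : ℝ → ℝ}
    (hk : Measurable k) (e : E) : Measurable (interactionDensity k e) := by
  unfold interactionDensity
  fun_prop

/-- The truncated interaction density is absolutely integrable. -/
lemma integrableOn_interactionDensity [SecondCountableTopology E] {μ : Measure E}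
    [μ.IsAddHaarMeasure] {k : ℝ → ℝ} (hk : Measurable k) (h0 : ∀ s, 0 < s → 0 ≤ k s)
    (hanti : AntitoneOn k (Ioi 0))
    (hi : Integrable (fun z : E => min 1 ‖z‖ * k ‖z‖) μ) (e : E) {ε ε' : ℝ}
    (hε : 0 < ε) (hε' : 0 < ε') :
    IntegrableOn (interactionDensity k e) {z | ε' < ‖e - z‖ ∧ ε < ‖z‖} μ := by
  have hs : MeasurableSet {z : E | ε < ‖z‖} := measurableSet_lt measurable_const measurable_norm
  have hs' : MeasurableSet {z : E | ε' < ‖e - z‖} :=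
    measurableSet_lt measurable_const (by fun_prop)
  have hint : IntegrableOn (fun z : E => k ‖z‖) {z | ε' < ‖e - z‖ ∧ ε < ‖z‖} μ :=
    (integrableOn_norm_gt hk hi hε).mono_set fun z hz => hz.2
  refine Integrable.mono' (hint.norm.const_mul (k ε'))
    (measurable_interactionDensity hk e).aestronglyMeasurable ?_
  filter_upwards [ae_restrict_mem (hs'.inter hs)] with z hz
  have hz1 : ε' < ‖e - z‖ := hz.1
  refine (abs_interactionDensity_le k e z).trans ?_
  rw [mul_comm, Real.norm_eq_abs]
  refine mul_le_mul_of_nonneg_right ?_ (abs_nonneg _)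
  rw [abs_of_nonneg (h0 _ (hε'.trans hz1))]
  exact hanti hε' (hε'.trans hz1) hz1.le

/-- The principal value at the origin of the interaction density exists. -/
lemma exists_tendsto_integral_annulus [FiniteDimensional ℝ E] {μ : Measure E}
    [μ.IsAddHaarMeasure] {k : ℝ → ℝ} (hk : Measurable k)
    (hi : Integrable (fun z : E => min 1 ‖z‖ * k ‖z‖) μ) {e : E} (he : ‖e‖ = 1)
    (hd : DifferentiableAt ℝ k 1) :
    ∃ δ₀ > 0, ∀ δ, 0 < δ → δ ≤ δ₀ → ∃ L, Tendsto
      (fun ε => ∫ z in {z : E | ε < ‖z‖ ∧ ‖z‖ ≤ δ}, interactionDensity k e z ∂μ)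
      (𝓝[>] 0) (𝓝 L) := by
  have he0 : e ≠ 0 := by
    rintro rfl
    simp at he
  -- F is the factor that is regular at the origin; `hd` is needed at 1 because ‖e - 0‖ = 1.
  set F : E → E := fun z => (k ‖e - z‖ * ‖e - z‖⁻¹) • (e - z) with hF
  have hFd : DifferentiableAt ℝ F 0 := by
    have hsub : DifferentiableAt ℝ (fun z : E => e - z) 0 := by fun_prop
    have hn : DifferentiableAt ℝ (fun z : E => ‖e - z‖) 0 :=
      hsub.norm ℝ (by simpa using he0)
    have hkn : DifferentiableAt ℝ (fun z : E => k ‖e - z‖) 0 :=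
      DifferentiableAt.comp (g := k) (0 : E) (by simpa [he] using hd) hn
    exact (hkn.mul (hn.inv (by simpa using he0))).smul hsub
  obtain ⟨C, hC⟩ := hFd.isBigO_sub.bound
  obtain ⟨δ₁, hδ₁, hball⟩ := Metric.eventually_nhds_iff.1 hC
  -- The half keeps the closed ball inside the open one of radius δ₁; the bound 1 makes min 1 ‖z‖
  -- equal ‖z‖.
  refine ⟨min (δ₁ / 2) 1, by positivity, fun δ hδ hδ₀ => ?_⟩
  have hlip : ∀ z : E, ‖z‖ ≤ δ → ‖F z - F 0‖ ≤ C * ‖z‖ := by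
    intro z hz
    have := hball (y := z) (by
      rw [dist_zero_right]
      have := hδ₀.trans (min_le_left _ _)
      linarith)
    simpa using this
  have hδ1 : δ ≤ 1 := hδ₀.trans (min_le_right _ _)
  have hmeas : ∀ ε : ℝ, MeasurableSet {z : E | ε < ‖z‖ ∧ ‖z‖ ≤ δ} := fun ε =>
    (measurableSet_lt measurable_const measurable_norm).inter
      (measurableSet_le measurable_norm measurable_const)
  set G : E → ℝ := fun z => k ‖z‖ * inner ℝ (F 0) (‖z‖⁻¹ • z) with hG
  have hGm : Measurable G := by
    rw [hG]
    fun_prop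
  have hIm := measurable_interactionDensity hk e
  have hbound : ∀ z : E, ‖z‖ ≤ δ →
      ‖interactionDensity k e z - G z‖ ≤ C * ‖min 1 ‖z‖ * k ‖z‖‖ := by
    intro z hz
    rw [interactionDensity_eq_inner, hG, ← mul_sub, ← inner_sub_left, norm_mul,
      min_eq_right (hz.trans hδ1), norm_mul, norm_norm]
    calc ‖k ‖z‖‖ * ‖inner ℝ (F z - F 0) (‖z‖⁻¹ • z)‖
        ≤ ‖k ‖z‖‖ * (C * ‖z‖ * 1) := by
          refine mul_le_mul_of_nonneg_left ?_ (norm_nonneg _)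
          refine (norm_inner_le_norm _ _).trans ?_
          have h1 := hlip z hz
          exact mul_le_mul h1 (norm_inv_norm_smul_le_one z) (norm_nonneg _)
            ((norm_nonneg _).trans h1)
      _ = C * (‖z‖ * ‖k ‖z‖‖) := by ring
  have hGint : ∀ ε > 0, IntegrableOn G {z : E | ε < ‖z‖ ∧ ‖z‖ ≤ δ} μ := by
    intro ε hε
    have hint : IntegrableOn (fun z : E => k ‖z‖) {z | ε < ‖z‖ ∧ ‖z‖ ≤ δ} μ :=
      (integrableOn_norm_gt hk hi hε).mono_set fun z hz => hz.1
    refine Integrable.mono' (hint.norm.mul_const ‖F 0‖) hGm.aestronglyMeasurable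
      (Eventually.of_forall fun z => ?_)
    rw [hG, norm_mul]
    refine mul_le_mul_of_nonneg_left ((norm_inner_le_norm _ _).trans ?_) (norm_nonneg _)
    exact mul_le_of_le_one_right (norm_nonneg _) (norm_inv_norm_smul_le_one z)
  -- G is odd and the annulus is symmetric under z ↦ -z.
  have hGzero : ∀ ε, ∫ z in {z : E | ε < ‖z‖ ∧ ‖z‖ ≤ δ}, G z ∂μ = 0 := by
    intro ε
    rw [← integral_indicator (hmeas ε)]
    have h := integral_neg_eq_self
      (({z : E | ε < ‖z‖ ∧ ‖z‖ ≤ δ}).indicator G) μ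
    have h2 : (fun z => ({z : E | ε < ‖z‖ ∧ ‖z‖ ≤ δ}).indicator G (-z)) =
        fun z => -({z : E | ε < ‖z‖ ∧ ‖z‖ ≤ δ}).indicator G z := by
      funext z
      by_cases hz : ε < ‖z‖ ∧ ‖z‖ ≤ δ <;> simp [indicator, hz, hG]
    rw [h2, integral_neg] at h
    linarith
  have hDint : IntegrableOn (fun z => interactionDensity k e z - G z)
      {z : E | 0 < ‖z‖ ∧ ‖z‖ ≤ δ} μ := by
    refine Integrable.mono' ((hi.norm.const_mul C).integrableOn)
      (hIm.sub hGm).aestronglyMeasurable ?_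
    filter_upwards [ae_restrict_mem (hmeas 0)] with z hz
    exact hbound z hz.2
  refine ⟨∫ z in {z : E | 0 < ‖z‖ ∧ ‖z‖ ≤ δ}, (interactionDensity k e z - G z) ∂μ, ?_⟩
  have hlim : Tendsto (fun ε => ∫ z in {z : E | ε < ‖z‖ ∧ ‖z‖ ≤ δ},
      (interactionDensity k e z - G z) ∂μ) (𝓝[>] 0)
      (𝓝 (∫ z in {z : E | 0 < ‖z‖ ∧ ‖z‖ ≤ δ}, (interactionDensity k e z - G z) ∂μ)) := by
    simp_rw [← integral_indicator (hmeas _)]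
    refine tendsto_integral_filter_of_dominated_convergence
      (({z : E | 0 < ‖z‖ ∧ ‖z‖ ≤ δ}).indicator fun z => ‖interactionDensity k e z - G z‖)
      (Eventually.of_forall fun ε =>
        ((hIm.sub hGm).indicator (hmeas ε)).aestronglyMeasurable) ?_
      (IntegrableOn.integrable_indicator hDint.norm (hmeas 0)) (Eventually.of_forall fun z => ?_)
    · filter_upwards [self_mem_nhdsWithin] with ε hε
      refine Eventually.of_forall fun z => ?_
      rw [norm_indicator_eq_indicator_norm]
      have hsub : {z : E | ε < ‖z‖ ∧ ‖z‖ ≤ δ} ⊆ {z : E | 0 < ‖z‖ ∧ ‖z‖ ≤ δ} :=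
        fun z hz => ⟨lt_trans hε hz.1, hz.2⟩
      exact indicator_le_indicator_of_subset hsub (fun _ => norm_nonneg _) z
    · refine tendsto_const_nhds.congr' ?_
      by_cases hz : 0 < ‖z‖
      · filter_upwards [mem_nhdsWithin_of_mem_nhds (Iio_mem_nhds hz)] with ε hε
        have hε' : ε < ‖z‖ := hε
        simp [indicator, hz, hε']
      · filter_upwards [self_mem_nhdsWithin] with ε hε
        have hε' : ¬ ε < ‖z‖ := fun h => hz (lt_trans hε h)
        simp only [indicator, mem_ofPred_eq, hz, hε', false_and, if_false]
  refine hlim.congr' ?_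
  filter_upwards [self_mem_nhdsWithin] with ε hε
  have hε0 : (0 : ℝ) < ε := hε
  have hD' : IntegrableOn (fun z => interactionDensity k e z - G z)
      {z : E | ε < ‖z‖ ∧ ‖z‖ ≤ δ} μ :=
    hDint.mono_set fun z hz => ⟨hε0.trans hz.1, hz.2⟩
  have := integral_add hD' (hGint ε hε0)
  simp only [sub_add_cancel] at this
  rw [this, hGzero, add_zero]

/-- The doubly truncated integrals of the interaction density converge as the two truncations are
removed independently. -/
lemma exists_tendsto_integral_truncation [FiniteDimensional ℝ E] {μ : Measure E}
    [μ.IsAddHaarMeasure] {k : ℝ → ℝ} (hk : Measurable k) (h0 : ∀ s, 0 < s → 0 ≤ k s)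
    (hanti : AntitoneOn k (Ioi 0))
    (hi : Integrable (fun z : E => min 1 ‖z‖ * k ‖z‖) μ) {e : E} (he : ‖e‖ = 1)
    (hd : DifferentiableAt ℝ k 1) :
    ∃ L, Tendsto (fun p : ℝ × ℝ =>
        ∫ z in {z : E | p.2 < ‖e - z‖ ∧ p.1 < ‖z‖}, interactionDensity k e z ∂μ)
      (𝓝[>] 0 ×ˢ 𝓝[>] 0) (𝓝 L) := by
  obtain ⟨δ₀, hδ₀, H⟩ := exists_tendsto_integral_annulus (μ := μ) hk hi he hd
  -- Any δ < 1/2 separates the balls around 0 and e, as 1 ≤ ‖e - z‖ + ‖z‖.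
  set δ := min δ₀ (1 / 4) with hδdef
  have hδ : 0 < δ := by positivity
  have hδ4 : δ ≤ 1 / 4 := min_le_right _ _
  obtain ⟨L, hL⟩ := H δ hδ (min_le_left _ _)
  set T : ℝ → ℝ → Set E := fun ε ε' => {z : E | ε' < ‖e - z‖ ∧ ε < ‖z‖} with hT
  have hsubm : Measurable fun z : E => ‖e - z‖ := by fun_prop
  set A : ℝ → Set E := fun ε => {z : E | ε < ‖z‖ ∧ ‖z‖ ≤ δ} with hA
  have hAm : ∀ ε, MeasurableSet (A ε) := fun ε =>
    (measurableSet_lt measurable_const measurable_norm).inter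
      (measurableSet_le measurable_norm measurable_const)
  set A' : ℝ → Set E := fun ε' => {z : E | ε' < ‖e - z‖ ∧ ‖e - z‖ ≤ δ} with hA'
  have hA'm : ∀ ε, MeasurableSet (A' ε) := fun ε =>
    (measurableSet_lt measurable_const hsubm).inter
      (measurableSet_le hsubm measurable_const)
  have hsym : ∀ ε', ∫ z in A' ε', interactionDensity k e z ∂μ =
      ∫ z in A ε', interactionDensity k e z ∂μ := by
    intro ε'
    rw [← integral_indicator (hAm ε'), ← integral_indicator (hA'm ε'),
      ← integral_sub_left_eq_self ((A ε').indicator (interactionDensity k e)) μ e]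
    refine integral_congr_ae (Eventually.of_forall fun z => ?_)
    simp only [indicator, hA, hA', mem_ofPred_eq, interactionDensity_sub]
  refine ⟨(∫ z in T δ δ, interactionDensity k e z ∂μ) + L + L, ?_⟩
  have hsum := ((tendsto_const_nhds (x := ∫ z in T δ δ, interactionDensity k e z ∂μ)).add
    (hL.comp tendsto_fst)).add (hL.comp (tendsto_snd (f := 𝓝[>] (0 : ℝ)) (g := 𝓝[>] (0 : ℝ))))
  refine hsum.congr' ?_
  have hmem : Ioo (0 : ℝ) δ ∈ 𝓝[>] (0 : ℝ) := Ioo_mem_nhdsGT hδ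
  filter_upwards [prod_mem_prod hmem hmem] with p hp
  obtain ⟨⟨hp1, hp1'⟩, hp2, hp2'⟩ := hp
  have htri : ∀ z : E, 1 ≤ ‖e - z‖ + ‖z‖ := fun z => by
    have := norm_add_le (e - z) z
    rwa [sub_add_cancel, he] at this
  have hunion : T p.1 p.2 = (T δ δ ∪ A p.1) ∪ A' p.2 := by
    ext z
    have := htri z
    simp only [hT, hA, hA', mem_union, mem_ofPred_eq]
    constructor
    · rintro ⟨h1, h2⟩
      by_cases h3 : ‖z‖ ≤ δ
      · exact Or.inl (Or.inr ⟨h2, h3⟩)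
      · by_cases h4 : ‖e - z‖ ≤ δ
        · exact Or.inr ⟨h1, h4⟩
        · exact Or.inl (Or.inl ⟨not_le.1 h4, not_le.1 h3⟩)
    · rintro ((h | h) | h) <;> constructor <;> linarith [h.1, h.2]
  have hdisj1 : Disjoint (T δ δ) (A p.1) :=
    Set.disjoint_left.2 fun z h1 h2 => not_lt.2 h2.2 h1.2
  have hdisj2 : Disjoint (T δ δ ∪ A p.1) (A' p.2) := by
    refine Set.disjoint_left.2 fun z h1 h2 => ?_
    rcases h1 with h1 | h1
    · exact not_lt.2 h2.2 h1.1
    · have := htri z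
      linarith [h1.2, h2.2]
  have hint : IntegrableOn (interactionDensity k e) (T p.1 p.2) μ :=
    integrableOn_interactionDensity hk h0 hanti hi e hp1 hp2
  have hint1 : IntegrableOn (interactionDensity k e) (T δ δ ∪ A p.1) μ :=
    hint.mono_set (hunion ▸ subset_union_left)
  have hint2 : IntegrableOn (interactionDensity k e) (A' p.2) μ :=
    hint.mono_set (hunion ▸ subset_union_right)
  change _ = ∫ z in T p.1 p.2, interactionDensity k e z ∂μ
  rw [hunion, setIntegral_union hdisj2 (hA'm _) hint1 hint2,
    setIntegral_union hdisj1 (hAm _) (hint1.mono_set subset_union_left)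
      (hint1.mono_set subset_union_right), hsym]
  rfl

end Kernel

/-! ### From the kernel ρ to the profile k -/

lemma eqIntegrand_eq_interactionDensity (d : ℕ) [NeZero d] (ρ : ℝ → ℝ) (r : ℝ) :
    eqIntegrand d ρ r = interactionDensity (fun s => ρ (r * s) / s) (firstVec d) := rfl

/-- Nothing controls ρ on (-∞, 0], so it is cut off there to obtain a measurable profile. At s = 0
both quotients are 0 by the convention for division by zero. -/
lemma eqIntegrand_indicator (d : ℕ) [NeZero d] (ρ : ℝ → ℝ) {r : ℝ} (hr : 0 < r) :
    eqIntegrand d ((Ioi 0).indicator ρ) r = eqIntegrand d ρ r := by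
  have key : ∀ s : ℝ, 0 ≤ s → (Ioi 0).indicator ρ (r * s) / s = ρ (r * s) / s := by
    intro s hs
    rcases hs.eq_or_lt with rfl | hs
    · simp
    · rw [indicator_of_mem (mem_Ioi.2 (mul_pos hr hs))]
  funext z
  unfold eqIntegrand
  rw [key _ (norm_nonneg _), key _ (norm_nonneg _)]

namespace IsRadialKernel

variable {d : ℕ} {ρ : ℝ → ℝ}

lemma div_nonneg (hρ : IsRadialKernel d ρ) {r : ℝ} (hr : 0 < r) : 0 ≤ ρ r / r :=
  _root_.div_nonneg (hρ.nonneg r hr) hr.le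

lemma antitoneOn_rescaled (hρ : IsRadialKernel d ρ) {r : ℝ} (hr : 0 < r) :
    AntitoneOn (fun s => ρ (r * s) / s) (Ioi 0) := by
  intro a ha b hb hab
  have ha' : (0 : ℝ) < a := ha
  have hb' : (0 : ℝ) < b := hb
  have h := hρ.antitone (mul_pos hr ha') (mul_pos hr hb') (mul_le_mul_of_nonneg_left hab hr.le)
  have h2 := mul_le_mul_of_nonneg_left h hr.le
  have hs : ∀ s : ℝ, r * (ρ (r * s) / (r * s)) = ρ (r * s) / s := fun s => by
    rw [mul_div_assoc', mul_div_mul_left _ _ hr.ne']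
  simpa only [hs] using h2

variable [NeZero d]

lemma integrableOn_div (hρ : IsRadialKernel d ρ) {r : ℝ} (hr : 0 < r) :
    IntegrableOn (fun θ : ℝ => ρ θ / θ) (Ioi r) := by
  -- In polar coordinates the weight is θ^(d-1), which is at least 1 for θ ≥ 1.
  have hrad := (integrable_fun_norm_addHaar
    (volume : Measure (EuclideanSpace ℝ (Fin d))) (f := fun s => min 1 s⁻¹ * ρ s)).1 hρ.integrable
  rw [finrank_euclideanSpace_fin] at hrad
  have hfar : IntegrableOn (fun θ : ℝ => ρ θ / θ) (Ioi (max r 1)) := by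
    refine Integrable.mono' (hrad.mono_set (Ioi_subset_Ioi (by positivity))) ?_ ?_
    · exact (aemeasurable_restrict_of_antitoneOn measurableSet_Ioi
        (hρ.antitone.mono (Ioi_subset_Ioi (by positivity)))).aestronglyMeasurable
    · filter_upwards [ae_restrict_mem measurableSet_Ioi] with θ hθ
      have h1 : 1 < θ := (le_max_right _ _).trans_lt hθ
      have h0 : 0 < θ := one_pos.trans h1
      have hn := hρ.div_nonneg h0
      rw [Real.norm_of_nonneg hn, min_eq_right (inv_le_one_of_one_le₀ h1.le), smul_eq_mul,
        inv_mul_eq_div]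
      exact le_mul_of_one_le_left hn (one_le_pow₀ h1.le)
  have hnear : IntegrableOn (fun θ : ℝ => ρ θ / θ) (Icc r (max r 1)) :=
    (hρ.antitone.mono fun x hx => hr.trans_le hx.1).integrableOn_isCompact isCompact_Icc
  refine (hnear.union hfar).mono_set fun x hx => ?_
  rcases le_or_gt x (max r 1) with h | h
  · exact Or.inl ⟨le_of_lt hx, h⟩
  · exact Or.inr h

lemma kernelPsi_sub_kernelPsi (hρ : IsRadialKernel d ρ) {a b : ℝ} (ha : 0 < a) (hab : a ≤ b) :
    kernelPsi ρ a - kernelPsi ρ b = ∫ θ in Ioc a b, ρ θ / θ := by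
  unfold kernelPsi
  have h := hρ.integrableOn_div ha
  rw [← Ioc_union_Ioi_eq_Ioi hab, setIntegral_union (Ioc_disjoint_Ioi le_rfl) measurableSet_Ioi
    (h.mono_set Ioc_subset_Ioi_self) (h.mono_set (Ioi_subset_Ioi hab)), add_sub_cancel_right]

/-- The tangent line inequality for the convex function `Ψ`. -/
lemma kernelPsi_tangent_le (hρ : IsRadialKernel d ρ) {x y : ℝ} (hx : 0 < x) (hy : 0 < y) :
    kernelPsi ρ x ≤ kernelPsi ρ y + ρ x / x * (y - x) := by
  have hconst : ∀ {a b : ℝ}, a ≤ b → ∫ _ in Ioc a b, ρ x / x = ρ x / x * (b - a) := by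
    intro a b hab
    rw [setIntegral_const, Measure.real, Real.volume_Ioc, ENNReal.toReal_ofReal (sub_nonneg.2 hab),
      smul_eq_mul, mul_comm]
  rcases le_total x y with h | h
  · have hsub := hρ.kernelPsi_sub_kernelPsi hx h
    have hle : ∫ θ in Ioc x y, ρ θ / θ ≤ ∫ _ in Ioc x y, ρ x / x :=
      setIntegral_mono_on ((hρ.integrableOn_div hx).mono_set Ioc_subset_Ioi_self)
        (integrableOn_const (by simp)) measurableSet_Ioc
        fun θ hθ => hρ.antitone hx (hx.trans hθ.1) hθ.1.le
    rw [hconst h] at hle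
    linarith
  · have hsub := hρ.kernelPsi_sub_kernelPsi hy h
    have hle : ∫ _ in Ioc y x, ρ x / x ≤ ∫ θ in Ioc y x, ρ θ / θ :=
      setIntegral_mono_on (integrableOn_const (by simp))
        ((hρ.integrableOn_div hy).mono_set Ioc_subset_Ioi_self) measurableSet_Ioc
        fun θ hθ => hρ.antitone (hy.trans hθ.1) hx hθ.2
    rw [hconst h] at hle
    linarith

/-- Continuity of ρ is not yet known; instead, Ψ minus its supporting line of slope -ρ(x)/x has a
minimum at x. -/
lemma deriv_kernelPsi (hρ : IsRadialKernel d ρ) {x : ℝ} (hx : 0 < x)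
    (hd : DifferentiableAt ℝ (kernelPsi ρ) x) : deriv (kernelPsi ρ) x = -(ρ x / x) := by
  have hmin : IsLocalMin (fun y => kernelPsi ρ y + ρ x / x * (y - x)) x := by
    filter_upwards [Ioi_mem_nhds hx] with y hy
    simpa using hρ.kernelPsi_tangent_le hx hy
  have hder : HasDerivAt (fun y => kernelPsi ρ y + ρ x / x * (y - x))
      (deriv (kernelPsi ρ) x + ρ x / x * 1) x :=
    hd.hasDerivAt.add (((hasDerivAt_id x).sub_const x).const_mul _)
  have := hmin.hasDerivAt_eq_zero hder
  linarith

lemma differentiableAt_profile (hρ : IsRadialKernel d ρ)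
    (hΨ : ContDiffOn ℝ 2 (kernelPsi ρ) (Ioi 0)) {x : ℝ} (hx : 0 < x) :
    DifferentiableAt ℝ ρ x := by
  have hd1 : ∀ y : ℝ, 0 < y → DifferentiableAt ℝ (kernelPsi ρ) y := fun y hy =>
    (hΨ.differentiableOn (by norm_num)).differentiableAt (Ioi_mem_nhds hy)
  have hd2 : DifferentiableAt ℝ (deriv (kernelPsi ρ)) x :=
    ((hΨ.deriv_of_isOpen (m := 1) isOpen_Ioi (by norm_num)).differentiableOn
      (by norm_num)).differentiableAt (Ioi_mem_nhds hx)
  refine (hd2.neg.mul differentiableAt_id).congr_of_eventuallyEq ?_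
  filter_upwards [Ioi_mem_nhds hx] with y hy
  have hy' : (0 : ℝ) < y := hy
  simp [hρ.deriv_kernelPsi hy' (hd1 y hy'), hy'.ne']

lemma measurable_indicator (hρ : IsRadialKernel d ρ)
    (hΨ : ContDiffOn ℝ 2 (kernelPsi ρ) (Ioi 0)) : Measurable ((Ioi 0).indicator ρ) := by
  have hc : ContinuousOn ρ (Ioi 0) := fun x hx =>
    (hρ.differentiableAt_profile hΨ hx).continuousAt.continuousWithinAt
  classical
  rw [← piecewise_eq_indicator]
  exact hc.measurable_piecewise continuousOn_const measurableSet_Ioi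

lemma integrable_rescaled (hρ : IsRadialKernel d ρ)
    (hΨ : ContDiffOn ℝ 2 (kernelPsi ρ) (Ioi 0)) {r : ℝ} (hr : 0 < r) :
    Integrable (fun z : EuclideanSpace ℝ (Fin d) =>
      min 1 ‖z‖ * ((Ioi 0).indicator ρ (r * ‖z‖) / ‖z‖)) := by
  have hm := hρ.measurable_indicator hΨ
  have h := hρ.integrable.comp_smul hr.ne'
  -- The constant comes from min(1, |z|) ≤ max(1, r) · min(|z|, 1/r).
  refine Integrable.mono' (h.norm.const_mul (max 1 r)) (by fun_prop)
    (Eventually.of_forall fun z => ?_)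
  rcases (norm_nonneg z).eq_or_lt with hz | hz
  · rw [← hz]
    simp only [div_zero, mul_zero, norm_zero]
    positivity
  have hrz : 0 < r * ‖z‖ := mul_pos hr hz
  rw [indicator_of_mem (mem_Ioi.2 hrz), norm_smul, Real.norm_of_nonneg hr.le, norm_mul, norm_mul,
    norm_div, ← mul_assoc, mul_div_left_comm, mul_comm]
  refine mul_le_mul_of_nonneg_right ?_ (norm_nonneg _)
  rw [norm_norm, Real.norm_of_nonneg (by positivity), Real.norm_of_nonneg (by positivity),
    div_le_iff₀ hz, mul_assoc, min_mul_of_nonneg _ _ hz.le, one_mul]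
  have e1 : (r * ‖z‖)⁻¹ * ‖z‖ = r⁻¹ := by field_simp
  rw [e1, mul_min_of_nonneg _ _ (by positivity)]
  refine le_min ((min_le_right _ _).trans
    (le_mul_of_one_le_left hz.le (le_max_left _ _))) ((min_le_left _ _).trans ?_)
  rw [← div_eq_mul_inv, one_le_div hr]
  exact le_max_right _ _

end IsRadialKernel

/-! ### Measurability in η and conclusion -/

lemma measurableSet_truncationSet (d : ℕ) [NeZero d] (ε ε' : ℝ) :
    MeasurableSet (truncationSet d ε ε') := by
  have hsub : Measurable fun z => ‖firstVec d - z‖ := by fun_prop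
  exact (measurableSet_lt measurable_const hsub).inter
    (measurableSet_lt measurable_const measurable_norm)

lemma measurable_truncatedEqKernel (d : ℕ) [NeZero d] {ρ : ℝ → ℝ} (hρ : Measurable ρ)
    (ε ε' : ℝ) : Measurable (truncatedEqKernel d ρ ε ε') := by
  have h : Measurable (fun p : ℝ × EuclideanSpace ℝ (Fin d) =>
      (truncationSet d ε ε').indicator (eqIntegrand d ρ p.1) p.2) := by
    have h1 : Measurable (fun p : ℝ × EuclideanSpace ℝ (Fin d) => eqIntegrand d ρ p.1 p.2) := by
      unfold eqIntegrand
      fun_prop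
    exact h1.indicator (measurable_snd (measurableSet_truncationSet d ε ε'))
  have h2 := h.stronglyMeasurable.integral_prod_right' (ν := volume)
  unfold truncatedEqKernel
  exact (measurable_id.pow_const d).mul h2.measurable

theorem mainTheorem9 (d : ℕ) [NeZero d] (ρ : ℝ → ℝ) (hρ : IsRadialKernel d ρ)
    (hΨint : LocallyIntegrableOn (fun r : ℝ => r ^ (d - 1) * kernelPsi ρ r) (Ici 0))
    (hΨ : ContDiffOn ℝ 2 (kernelPsi ρ) (Ioi 0)) :
    -- `Ψ` is given by a convergent integral
    (∀ r : ℝ, 0 < r → IntegrableOn (fun θ : ℝ => ρ θ / θ) (Ioi r)) ∧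
    -- the truncated kernels are given by absolutely convergent integrals and are measurable
    (∀ ε ε' : ℝ, 0 < ε → 0 < ε' →
      (∀ η : EuclideanSpace ℝ (Fin d), 0 < ‖η‖ →
        Integrable ((truncationSet d ε ε').indicator (eqIntegrand d ρ ‖η‖))) ∧
      Measurable (fun η : EuclideanSpace ℝ (Fin d) => truncatedEqKernel d ρ ε ε' ‖η‖)) ∧
    -- they converge at every `η ≠ 0`
    (∀ η : EuclideanSpace ℝ (Fin d), 0 < ‖η‖ →
      Tendsto (fun p : ℝ × ℝ => truncatedEqKernel d ρ p.1 p.2 ‖η‖)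
        (𝓝[>] (0 : ℝ) ×ˢ 𝓝[>] (0 : ℝ)) (𝓝 (eqKernel d ρ ‖η‖))) := by
  have hm := hρ.measurable_indicator hΨ
  have hind : ∀ r : ℝ, 0 < r → eqIntegrand d ρ r =
      interactionDensity (fun s => (Ioi 0).indicator ρ (r * s) / s) (firstVec d) := fun r hr => by
    rw [← eqIntegrand_indicator d ρ hr, eqIntegrand_eq_interactionDensity]
  have hkm : ∀ r : ℝ, Measurable fun s => (Ioi 0).indicator ρ (r * s) / s := fun r => by fun_prop
  have heq : ∀ r : ℝ, 0 < r → EqOn (fun s => ρ (r * s) / s)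
      (fun s => (Ioi 0).indicator ρ (r * s) / s) (Ioi 0) := fun r hr s hs => by
    simp only [indicator_of_mem (mem_Ioi.2 (mul_pos hr hs))]
  have hk0 : ∀ r : ℝ, 0 < r → ∀ s : ℝ, 0 < s → 0 ≤ (Ioi 0).indicator ρ (r * s) / s :=
    fun r hr s hs => div_nonneg (indicator_nonneg hρ.nonneg _) hs.le
  have hka : ∀ r : ℝ, 0 < r → AntitoneOn (fun s => (Ioi 0).indicator ρ (r * s) / s) (Ioi 0) :=
    fun r hr => (hρ.antitoneOn_rescaled hr).congr (heq r hr)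
  refine ⟨fun r hr => hρ.integrableOn_div hr, fun ε ε' hε hε' => ⟨fun η hη => ?_, ?_⟩,
    fun η hη => ?_⟩
  · rw [hind _ hη, integrable_indicator_iff (measurableSet_truncationSet d ε ε')]
    exact integrableOn_interactionDensity (hkm _) (hk0 _ hη) (hka _ hη)
      (hρ.integrable_rescaled hΨ hη) _ hε hε'
  · have : (fun η : EuclideanSpace ℝ (Fin d) => truncatedEqKernel d ρ ε ε' ‖η‖) =
        fun η => truncatedEqKernel d ((Ioi 0).indicator ρ) ε ε' ‖η‖ := by
      funext η
      unfold truncatedEqKernel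
      rcases (norm_nonneg η).eq_or_lt with h | h
      -- At η = 0 the prefactor 0 ^ d vanishes because d ≠ 0.
      · simp [← h, NeZero.ne d]
      · rw [eqIntegrand_indicator d ρ h]
    rw [this]
    exact (measurable_truncatedEqKernel d hm ε ε').comp measurable_norm
  · refine tendsto_nhds_limUnder ?_
    have hdiff : DifferentiableAt ℝ (fun s => (Ioi 0).indicator ρ (‖η‖ * s) / s) 1 := by
      have h1 : DifferentiableAt ℝ (fun s => ρ (‖η‖ * s) / s) 1 :=
        (DifferentiableAt.comp (g := ρ) (1 : ℝ)
          (by simpa using hρ.differentiableAt_profile hΨ hη)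
          (differentiableAt_id.const_mul ‖η‖)).div differentiableAt_id one_ne_zero
      exact h1.congr_of_eventuallyEq
        ((heq _ hη).symm.eventuallyEq_of_mem (Ioi_mem_nhds one_pos))
    obtain ⟨L, hL⟩ := exists_tendsto_integral_truncation (hkm ‖η‖) (hk0 _ hη) (hka _ hη)
      (hρ.integrable_rescaled hΨ hη) (e := firstVec d) (by simp [firstVec]) hdiff
    refine ⟨‖η‖ ^ d * L, (hL.const_mul (‖η‖ ^ d)).congr fun p => ?_⟩
    unfold truncatedEqKernel
    rw [hind _ hη, integral_indicator (measurableSet_truncationSet d p.1 p.2)]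
    rfl
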